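/- Let $\Sigma=\{a,b\}$ and let $\Sigma^*$ be the set of finite words over $\Sigma$; a factor of a word $w$ is a word $z$ with $w=uzv$ for some $u,v\in\Sigma^*$, and $|w|_a$ is the number of occurrences of $a$ in $w$. A word $w\in\Sigma^*$ is Sturmian if it is balanced, i.e. $\bigl||u|_a-|v|_a\bigr|\le 1$ for any two factors $u,v$ of $w$ of the same length; let $\mathit{St}$ be the language of Sturmian words. A minimal forbidden word for a language $L$ is a word that is not in $L$ but all of whose proper factors are in $L$; let $\mathit{MF}_{\mathit{St}}$ be the set of minimal forbidden words for $\mathit{St}$. For integers $p,q>0$ and $n=p+q$, the lower Christoffel word $w_{p,q}$ is the word of length $n$ whose $i$-th letter ($1\le i\le n$) is $a$ if $(iq \bmod n)>((i-1)q \bmod n)$ and $b$ if $(iq \bmod n)<((i-1)q \bmod n)$; the upper Christoffel word $w'_{p,q}$ is the word of length $n$ whose $i$-th letter is $a$ if $(ip \bmod n)<((i-1)p \bmod n)$ and $b$ if $(ip \bmod n)>((i-1)p \bmod n)$. A Christoffel word is a lower or an upper Christoffel word ($p$ and $q$ need not be coprime). A word is primitive if it is not the concatenation of two or more copies of some word.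 Theorem. The minimal forbidden words for $\mathit{St}$ are exactly the words $ywx$ such that $xwy$ is a non-primitive Christoffel word, where $\{x,y\}=\{a,b\}$: $$\mathit{MF}_{\mathit{St}}=\{\,ywx \mid w\in\Sigma^*,\ \{x,y\}=\{a,b\},\ xwy \text{ is a non-primitive Christoffel word}\,\}.$$ -/

import Mathlib

namespace SturmianWords

/-- The binary alphabet `{a, b}`. -/
inductive Letter where
  | a : Letter
  | b : Letter
  deriving DecidableEq

/-- Finite words over `{a, b}`; `u <:+: w` says that `u` is a factor of `w`. -/
abbrev Word := List Letter

/-- A word is balanced if any two of its factors of the same length have numbers of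
occurrences of the letter `a` that differ by at most one. -/
def IsBalanced (w : Word) : Prop :=
  ∀ u v : Word, u <:+: w → v <:+: w → u.length = v.length →
    |(u.count Letter.a : ℤ) - (v.count Letter.a : ℤ)| ≤ 1

/-- The language `St` of finite Sturmian words, that is, of balanced words. -/
def sturmianLanguage : Language Letter :=
  {w : Word | IsBalanced w}

/-- The set of minimal forbidden words of a language `L`: the words that are not in `L`
although all their proper factors are. -/
def minimalForbiddenWords {α : Type*} (L : Language α) : Language α :=
  {v : List α | v ∉ L ∧ ∀ u : List α, u <:+: v → u ≠ v → u ∈ L}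

/-- A word is a power if it is the concatenation of at least two copies of some word. -/
def IsPower {α : Type*} (w : List α) : Prop :=
  ∃ (u : List α) (k : ℕ), 2 ≤ k ∧ w = (List.replicate k u).flatten

/-- A word is primitive if it is not a power. -/
def IsPrimitive {α : Type*} (w : List α) : Prop :=
  ¬ IsPower w

/-- The lower Christoffel word `w_{p,q}`, of length `n = p + q`. The index `i` starts at `0`, and
for `p, q > 0` consecutive multiples of `q` are distinct modulo `n`, so that "not `>`" means `<`. -/
def lowerChristoffel (p q : ℕ) : Word :=
  List.ofFn fun i : Fin (p + q) =>
    if ((i : ℕ) + 1) * q % (p + q) > (i : ℕ) * q % (p + q) then Letter.a else Letter.b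

/-- The upper Christoffel word `w'_{p,q}`, of length `n = p + q`; indices as for the lower one. -/
def upperChristoffel (p q : ℕ) : Word :=
  List.ofFn fun i : Fin (p + q) =>
    if ((i : ℕ) + 1) * p % (p + q) < (i : ℕ) * p % (p + q) then Letter.a else Letter.b

/-- Christoffel words, lower or upper, for positive `p` and `q` (not necessarily coprime). -/
def IsChristoffel (w : Word) : Prop :=
  ∃ p q : ℕ, 0 < p ∧ 0 < q ∧ (w = lowerChristoffel p q ∨ w = upperChristoffel p q)

end SturmianWords

/-!
Let `n` be the length of `xwy`, and let `G i` count the letters `y` among the first `i` letters of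
the infinite word `(xwy)(xwy)⋯`. The word `xwy` is Christoffel iff `G i = ⌊i * G n / n⌋`,
equivalently iff `G` is superadditive with defect at most one, and it is a power iff
`G (i + k) = G i + G k` for some `0 < k < n` and all `i`.

The prefix counts `P` of `y` in `ywx` agree with `G` at `0` and `n` and exceed it by one in between.
If `xwy` is Christoffel, then raising `G` in this way keeps the two longest proper factors balanced,
and additivity along `k` makes the prefix of length `k` of `ywx` contain two more letters `y` than
the suffix of length `k`. Conversely, in a minimal forbidden word the unbalance is between a prefix
and a suffix of some length `k`, and if the prefix is the heavier one for `y`, the word has the form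
`ywx`. Comparing windows of length `k` in the two longest proper factors then gives additivity along
`k`, hence periodicity with a period `d ≤ n / 2`, and windows that fit between the ends of `ywx`
bound the defect of superadditivity.
-/

namespace SturmianWords

section IsAdditiveAlong

/-- `G` has constant increments over intervals of length `n`, equal to `G n`. This is periodicity
of the increments of `G`, as for the prefix counts of an infinite word of period `n`; in particular
`G 0 = 0`. -/
def IsAdditiveAlong {A : Type*} [Add A] (G : ℕ → A) (n : ℕ) : Prop :=
  ∀ i, G (i + n) = G i + G n

namespace IsAdditiveAlong

variable {A : Type*} [AddCommGroup A] {G H : ℕ → A} {k n : ℕ}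

theorem map_zero (hn : IsAdditiveAlong G n) : G 0 = 0 := by
  simpa using hn 0

theorem map_add_mul (hn : IsAdditiveAlong G n) (i t : ℕ) : G (i + n * t) = G i + t • G n := by
  induction t with
  | zero => simp
  | succ t ih => rw [mul_add_one, ← add_assoc, hn, ih, succ_nsmul, add_assoc]

theorem mul (hn : IsAdditiveAlong G n) (t : ℕ) : IsAdditiveAlong G (n * t) := fun i => by
  have h := hn.map_add_mul 0 t
  rw [zero_add, hn.map_zero, zero_add] at h
  rw [hn.map_add_mul, h]

theorem of_add_left (hn : IsAdditiveAlong G n) (hnk : IsAdditiveAlong G (n + k)) :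
    IsAdditiveAlong G k := fun i => by
  have h_total : G (n + k) = G k + G n := by rw [add_comm n, hn]
  have h_shift : G (i + k) + G n = G i + G k + G n := by
    rw [← hn, add_assoc, add_comm k, hnk, h_total, add_assoc]
  exact add_right_cancel h_shift

theorem gcd (hk : IsAdditiveAlong G k) (hn : IsAdditiveAlong G n) :
    IsAdditiveAlong G (k.gcd n) := by
  induction k, n using Nat.gcd.induction with
  | H0 n => simpa using hn
  | H1 k n _ ih =>
    rw [Nat.gcd_rec]
    exact ih ((hk.mul (n / k)).of_add_left (by rwa [Nat.div_add_mod])) hk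

theorem map_eq_mod_add_div (hn : IsAdditiveAlong G n) (i : ℕ) :
    G i = G (i % n) + (i / n) • G n := by
  rw [← hn.map_add_mul, Nat.mod_add_div]

theorem ext (hG : IsAdditiveAlong G n) (hH : IsAdditiveAlong H n) (hn : 0 < n)
    (h : ∀ i ≤ n, G i = H i) : G = H := by
  funext i
  rw [hG.map_eq_mod_add_div, hH.map_eq_mod_add_div, h n le_rfl, h _ (Nat.mod_lt i hn).le]

theorem of_forall_lt (hn : IsAdditiveAlong G n) (hn0 : 0 < n)
    (h : ∀ i < n, G (i + k) = G i + G k) : IsAdditiveAlong G k := fun i => by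
  have h_index : i + k = i % n + k + n * (i / n) := by
    rw [add_right_comm, Nat.mod_add_div]
  rw [h_index, hn.map_add_mul, h _ (Nat.mod_lt i hn0), hn.map_eq_mod_add_div i, add_right_comm]

end IsAdditiveAlong

end IsAdditiveAlong

section AlmostAdditive

/-- `G` is superadditive with defect at most one. Together with additivity along some `n > 0`, this
characterizes the functions `i ↦ ⌊i * q / n⌋`. -/
def AlmostAdditive (G : ℕ → ℤ) : Prop :=
  ∀ i j, G i + G j ≤ G (i + j) ∧ G (i + j) ≤ G i + G j + 1

variable {G : ℕ → ℤ} {n : ℕ}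

theorem AlmostAdditive.mul_le_map_mul (hG : AlmostAdditive G) (h0 : G 0 = 0) (i t : ℕ) :
    t * G i ≤ G (t * i) := by
  induction t with
  | zero => simp [h0]
  | succ t ih =>
    have := (hG (t * i) i).1
    rw [add_one_mul]
    push_cast
    linarith

theorem AlmostAdditive.map_mul_lt (hG : AlmostAdditive G) (i : ℕ) {t : ℕ} (ht : 0 < t) :
    G (t * i) < t * (G i + 1) := by
  induction t, ht using Nat.le_induction with
  | base => simp
  | succ t _ ih =>
    have := (hG (t * i) i).2
    rw [add_one_mul]
    push_cast
    linarith

/-- Averaging: `n * G i` and `G (n * i) = i * G n` differ by less than `n`. -/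
theorem AlmostAdditive.eq_floor (hG : AlmostAdditive G) (hn : IsAdditiveAlong G n) (hn0 : 0 < n)
    (i : ℕ) : G i = i * G n / n := by
  have h_mul : G (n * i) = i * G n := by
    simpa [hn.map_zero] using hn.map_add_mul 0 i
  have h_lower := hG.mul_le_map_mul hn.map_zero i n
  have h_upper := hG.map_mul_lt i hn0
  rw [h_mul] at h_lower h_upper
  rw [eq_comm, Int.ediv_eq_iff_of_pos (by exact_mod_cast hn0)]
  constructor <;> linarith

theorem almostAdditive_floor (c : ℤ) {d : ℤ} (hd : 0 < d) :
    AlmostAdditive fun i => i * c / d := fun i j => by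
  have h_add : ((i + j : ℕ) : ℤ) * c = i * c + j * c := by push_cast; ring
  dsimp only
  rw [h_add, Int.add_ediv_of_pos hd]
  split_ifs <;> omega

theorem isAdditiveAlong_floor (c : ℤ) (hn : 0 < n) :
    IsAdditiveAlong (fun i => (i : ℤ) * c / n) n := fun i => by
  have hn' : (n : ℤ) ≠ 0 := by exact_mod_cast hn.ne'
  push_cast
  rw [add_mul, Int.add_mul_ediv_left _ _ hn', Int.mul_ediv_cancel_left _ hn']

theorem almostAdditive_of_forall_lt (hn : IsAdditiveAlong G n) (hn0 : 0 < n)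
    (h : ∀ i < n, ∀ j < n, G i + G j ≤ G (i + j) ∧ G (i + j) ≤ G i + G j + 1) :
    AlmostAdditive G := fun i j => by
  have h_index : i + j = i % n + j % n + n * (i / n + j / n) := by
    have := Nat.mod_add_div i n
    have := Nat.mod_add_div j n
    rw [mul_add]
    omega
  have h_sum := hn.map_add_mul (i % n + j % n) (i / n + j / n)
  rw [← h_index, add_nsmul] at h_sum
  have hi := hn.map_eq_mod_add_div i
  have hj := hn.map_eq_mod_add_div j
  have := h _ (Nat.mod_lt i hn0) _ (Nat.mod_lt j hn0)
  constructor <;> linarith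

end AlmostAdditive

section BalancedOn

/-- The increments of `P` over any two intervals of equal length inside `[s, e]` differ by at most
one. When `P` counts a letter in the prefixes of a word, this says that the factor between the
positions `s` and `e` is balanced. -/
def BalancedOn (P : ℕ → ℤ) (s e : ℕ) : Prop :=
  ∀ i j m : ℕ, s ≤ i → s ≤ j → i + m ≤ e → j + m ≤ e → P (i + m) - P i ≤ P (j + m) - P j + 1

/-- The analogue for prefix counts on `[0, n]` of a minimal forbidden word of length `n`. -/
def MinimallyUnbalanced (P : ℕ → ℤ) (n : ℕ) : Prop :=
  ¬ BalancedOn P 0 n ∧ BalancedOn P 1 n ∧ BalancedOn P 0 (n - 1)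

/-- `P` agrees with `G` at `0` and at `n` and exceeds it by one in between. This relates the prefix
counts of the letter `y` in the words `ywx` and `xwy`. -/
structure InteriorRaise (P G : ℕ → ℤ) (n : ℕ) : Prop where
  zero : P 0 = G 0
  last : P n = G n
  interior : ∀ i, 0 < i → i < n → P i = G i + 1

variable {P G : ℕ → ℤ} {k n : ℕ}

theorem balancedOn_shift (P : ℕ → ℤ) (s e : ℕ) :
    BalancedOn (fun i => P (s + i)) 0 (e - s) ↔ BalancedOn P s e := by
  constructor <;> intro h i j m hi hj hie hje
  · have := h (i - s) (j - s) m (Nat.zero_le _) (Nat.zero_le _) (by omega) (by omega)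
    dsimp only at this
    rwa [← add_assoc, ← add_assoc, Nat.add_sub_of_le hi, Nat.add_sub_of_le hj] at this
  · rcases Nat.eq_zero_or_pos m with rfl | hm
    · simp
    · simpa only [add_assoc] using
        h (s + i) (s + j) m (by omega) (by omega) (by omega) (by omega)

theorem MinimallyUnbalanced.exists_prefix_suffix (hP : MinimallyUnbalanced P n) :
    ∃ k, 0 < k ∧ k < n ∧
      (2 ≤ P k - P 0 - (P n - P (n - k)) ∨ 2 ≤ P n - P (n - k) - (P k - P 0)) := by
  obtain ⟨h_unbalanced, h_suffix, h_prefix⟩ := hP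
  simp only [BalancedOn, not_forall, not_le] at h_unbalanced
  obtain ⟨i, j, m, -, -, hi, hj, h⟩ := h_unbalanced
  have hm : m ≠ 0 := by rintro rfl; simp at h
  have hij : i ≠ j := by rintro rfl; omega
  have h_start : i = 0 ∨ j = 0 := by
    by_contra
    have := h_suffix i j m (by omega) (by omega) hi hj
    omega
  have h_end : i + m = n ∨ j + m = n := by
    by_contra
    have := h_prefix i j m (by omega) (by omega) (by omega) (by omega)
    omega
  refine ⟨m, by omega, by omega, ?_⟩
  rcases h_start with rfl | rfl
  · obtain rfl : n = j + m := by omega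
    rw [Nat.add_sub_cancel]
    rw [zero_add] at h
    omega
  · obtain rfl : n = i + m := by omega
    rw [Nat.add_sub_cancel]
    rw [zero_add] at h
    omega

namespace InteriorRaise

theorem not_balancedOn (hPG : InteriorRaise P G n) (hk : IsAdditiveAlong G k) (hk0 : 0 < k)
    (hkn : k < n) : ¬ BalancedOn P 0 n := fun h => by
  have h_windows := h 0 (n - k) k le_rfl (Nat.zero_le _) (by omega) (by omega)
  have h_split := hk (n - k)
  rw [Nat.sub_add_cancel hkn.le] at h_windows h_split
  rw [zero_add, hPG.zero, hPG.last, hPG.interior k hk0 hkn,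
    hPG.interior (n - k) (by omega) (by omega), hk.map_zero] at h_windows
  omega

theorem balancedOn_suffix (hPG : InteriorRaise P G n) (hG : AlmostAdditive G)
    (hn : IsAdditiveAlong G n) : BalancedOn P 1 n := fun i j m hi hj hie hje => by
  rcases Nat.eq_zero_or_pos m with rfl | hm
  · simp
  have hi_add := hG i m
  have hj_add := hG j m
  rw [hPG.interior i hi (by omega), hPG.interior j hj (by omega)]
  rcases hie.lt_or_eq with hie | hie
  · rw [hPG.interior (i + m) (by omega) hie]
    rcases hje.lt_or_eq with hje | hje
    · rw [hPG.interior (j + m) (by omega) hje]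
      omega
    · have h_wrap := (hG (i + m) j).1
      rw [add_assoc, add_comm m, hje, hn] at h_wrap
      rw [hje, hPG.last]
      omega
  · rw [hie] at hi_add
    rw [hie, hPG.last]
    rcases hje.lt_or_eq with hje | hje
    · rw [hPG.interior (j + m) (by omega) hje]
      omega
    · obtain rfl : i = j := by omega
      rw [hje, hPG.last]
      omega

theorem balancedOn_prefix (hPG : InteriorRaise P G n) (hG : AlmostAdditive G) (h0 : G 0 = 0) :
    BalancedOn P 0 (n - 1) := fun i j m _ _ hie hje => by
  rcases Nat.eq_zero_or_pos m with rfl | hm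
  · simp
  have hi_add := hG i m
  have hj_add := hG j m
  rw [hPG.interior (i + m) (by omega) (by omega), hPG.interior (j + m) (by omega) (by omega)]
  rcases Nat.eq_zero_or_pos j with rfl | hj
  · have h_le : G i ≤ P i := by
      rcases Nat.eq_zero_or_pos i with rfl | hi
      · exact hPG.zero.ge
      · rw [hPG.interior i hi (by omega)]
        omega
    rw [zero_add, hPG.zero]
    omega
  · rw [hPG.interior j hj (by omega)]
    rcases Nat.eq_zero_or_pos i with rfl | hi
    · rw [zero_add, hPG.zero]
      omega
    · rw [hPG.interior i hi (by omega)]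
      omega

theorem minimallyUnbalanced (hPG : InteriorRaise P G n) (hG : AlmostAdditive G)
    (hn : IsAdditiveAlong G n) (hk : IsAdditiveAlong G k) (hk0 : 0 < k) (hkn : k < n) :
    MinimallyUnbalanced P n :=
  ⟨hPG.not_balancedOn hk hk0 hkn, hPG.balancedOn_suffix hG hn,
    hPG.balancedOn_prefix hG hn.map_zero⟩

theorem add_le_map_add (hPG : InteriorRaise P G n) (h : BalancedOn P 0 (n - 1)) (h0 : G 0 = 0)
    {i m : ℕ} (hi : 0 < i) (hm : 0 < m) (him : i + m < n) : G i + G m ≤ G (i + m) := by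
  have h_windows := h 0 i m le_rfl (Nat.zero_le _) (by omega) (by omega)
  rw [zero_add, hPG.zero, h0, hPG.interior m hm (by omega), hPG.interior i hi (by omega),
    hPG.interior (i + m) (by omega) him] at h_windows
  omega

theorem map_add_sub_le_last_sub (hPG : InteriorRaise P G n) (h : BalancedOn P 1 n)
    {i m : ℕ} (hi : 0 < i) (hm : 0 < m) (him : i + m < n) :
    G (i + m) - G i ≤ G n - G (n - m) := by
  have h_windows := h i (n - m) m hi (by omega) (by omega) (by omega)
  rw [Nat.sub_add_cancel (by omega), hPG.last, hPG.interior i hi (by omega),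
    hPG.interior (i + m) (by omega) him, hPG.interior (n - m) (by omega) (by omega)] at h_windows
  omega

theorem map_add_sub_le (hPG : InteriorRaise P G n) (h : BalancedOn P 1 n) {i j m : ℕ}
    (hi : 0 < i) (hj : 0 < j) (him : i + m < n) (hjm : j + m < n) :
    G (i + m) - G i ≤ G (j + m) - G j + 1 := by
  have h_windows := h i j m hi hj him.le hjm.le
  rw [hPG.interior i hi (by omega), hPG.interior j hj (by omega),
    hPG.interior (i + m) (by omega) him, hPG.interior (j + m) (by omega) hjm] at h_windows
  omega

theorem map_add_of_last_le (hPG : InteriorRaise P G n) (h_suffix : BalancedOn P 1 n)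
    (h_prefix : BalancedOn P 0 (n - 1)) (h0 : G 0 = 0) (hk0 : 0 < k)
    (hk : G n ≤ G k + G (n - k)) {i : ℕ} (hi : 0 < i) (hin : i + k < n) :
    G (i + k) = G i + G k ∧ G n = G k + G (n - k) := by
  have h_lower := hPG.add_le_map_add h_prefix h0 hi hk0 hin
  have h_upper := hPG.map_add_sub_le_last_sub h_suffix hi hk0 hin
  omega

/-- Additivity along `k` is checked on `[0, n]` continued `n`-periodically; past `n` it becomes
additivity along `n - k`. -/
theorem isAdditiveAlong_of_last_le (hPG : InteriorRaise P G n) (h_suffix : BalancedOn P 1 n)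
    (h_prefix : BalancedOn P 0 (n - 1)) (hn : IsAdditiveAlong G n)
    (h_ends : G 1 + G (n - 1) < G n) (hk0 : 0 < k) (hkn : k < n)
    (hk : G n ≤ G k + G (n - k)) : IsAdditiveAlong G k := by
  have h0 := hn.map_zero
  have hk_ne_one : k ≠ 1 := by rintro rfl; omega
  have hk_ne_pred : n - k ≠ 1 := fun h => by
    rw [h, show k = n - 1 by omega] at hk
    omega
  have h_last : G n = G k + G (n - k) :=
    (hPG.map_add_of_last_le h_suffix h_prefix h0 hk0 hk one_pos (by omega)).2
  refine hn.of_forall_lt (by omega) fun i hi => ?_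
  rcases Nat.eq_zero_or_pos i with rfl | hi0
  · simp [h0]
  rcases lt_trichotomy (i + k) n with hik | hik | hik
  · exact (hPG.map_add_of_last_le h_suffix h_prefix h0 hk0 hk hi0 hik).1
  · rw [hik, h_last, show i = n - k by omega, add_comm]
  · obtain ⟨t, rfl⟩ : ∃ t, i = t + (n - k) := ⟨i - (n - k), by omega⟩
    have h_shift := (hPG.map_add_of_last_le h_suffix h_prefix h0 (k := n - k) (by omega)
      (by rw [Nat.sub_sub_self hkn.le]; omega) (i := t) (by omega) hi).1
    rw [add_assoc, Nat.sub_add_cancel hkn.le, hn, h_shift, h_last]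
    ring

/-- Up to shifts by `d = gcd k n ≤ n / 2`, all the intervals to be compared lie inside `[1, n - 1]`,
and `[d, d + m]` has the same increment as `[0, m]`. -/
theorem almostAdditive (hPG : InteriorRaise P G n) (h_suffix : BalancedOn P 1 n)
    (h_prefix : BalancedOn P 0 (n - 1)) (hn : IsAdditiveAlong G n) (hk : IsAdditiveAlong G k)
    (hk0 : 0 < k) (hkn : k < n) : AlmostAdditive G := by
  have h0 := hn.map_zero
  have hd := hk.gcd hn
  have hd0 : 0 < k.gcd n := Nat.gcd_pos_of_pos_left n hk0
  have hdn : 2 * k.gcd n ≤ n := by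
    have h_le : k.gcd n ≤ n - k := Nat.le_of_dvd (by omega)
      (Nat.dvd_sub (Nat.gcd_dvd_right k n) (Nat.gcd_dvd_left k n))
    have := Nat.gcd_le_left n hk0
    omega
  refine almostAdditive_of_forall_lt hd hd0 fun i hi m hm => ?_
  rcases Nat.eq_zero_or_pos i with rfl | hi0
  · simp [h0]
  rcases Nat.eq_zero_or_pos m with rfl | hm0
  · simp [h0]
  have h_lower := hPG.add_le_map_add h_prefix h0 hi0 hm0 (by omega)
  have h_upper := hPG.map_add_sub_le h_suffix (m := m) hi0 hd0 (by omega) (by omega)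
  rw [add_comm (k.gcd n), hd] at h_upper
  omega

end InteriorRaise

end BalancedOn

section PrefixCount

variable {α : Type*} [DecidableEq α]

/-- The number of occurrences of the letter `x` in the prefix of length `i` of `u`. It is an integer
because increments of prefix counts get subtracted from one another. -/
def prefixCount (x : α) (u : List α) (i : ℕ) : ℤ := (u.take i).count x

/-- The number of occurrences of the letter `x` among the first `i` letters of `uuu⋯`. -/
def periodicCount (x : α) (u : List α) (i : ℕ) : ℤ :=
  prefixCount x u (i % u.length) + (i / u.length) • (u.count x : ℤ)

variable (x : α) (u : List α)

@[simp] theorem prefixCount_zero : prefixCount x u 0 = 0 := by simp [prefixCount]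

@[simp] theorem prefixCount_length : prefixCount x u u.length = u.count x := by simp [prefixCount]

theorem prefixCount_succ {i : ℕ} (hi : i < u.length) :
    prefixCount x u (i + 1) = prefixCount x u i + if u[i] = x then 1 else 0 := by
  rw [prefixCount, prefixCount, List.take_add_one, List.getElem?_eq_getElem hi, Option.toList_some,
    List.count_append, List.count_singleton]
  simp

theorem prefixCount_add (i m : ℕ) :
    prefixCount x u (i + m) = prefixCount x u i + ((u.drop i).take m).count x := by
  simp [prefixCount, List.take_add]

theorem prefixCount_drop_take {s e i : ℕ} (h : s + i ≤ e) :
    prefixCount x ((u.take e).drop s) i = prefixCount x u (s + i) - prefixCount x u s := by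
  rw [prefixCount_add, prefixCount, List.drop_take, List.take_take, min_eq_left (by omega)]
  ring

theorem prefixCount_append_add_length (v : List α) (i : ℕ) :
    prefixCount x (u ++ v) (u.length + i) = u.count x + prefixCount x v i := by
  simp [prefixCount, List.take_append, List.take_of_length_le]

theorem prefixCount_append_of_le {v : List α} {i : ℕ} (hi : i ≤ u.length) :
    prefixCount x (u ++ v) i = prefixCount x u i := by
  rw [prefixCount, prefixCount, List.take_append_of_le_length hi]

theorem periodicCount_of_le {i : ℕ} (hi : i ≤ u.length) :
    periodicCount x u i = prefixCount x u i := by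
  rcases hi.lt_or_eq with hi | rfl
  · simp [periodicCount, Nat.mod_eq_of_lt hi, Nat.div_eq_of_lt hi]
  · rcases Nat.eq_zero_or_pos u.length with hu | hu
    · simp [periodicCount, hu]
    · simp [periodicCount, Nat.div_self hu]

theorem periodicCount_length : periodicCount x u u.length = u.count x := by
  rw [periodicCount_of_le x u le_rfl, prefixCount_length]

theorem isAdditiveAlong_periodicCount_length : IsAdditiveAlong (periodicCount x u) u.length := by
  intro i
  rcases Nat.eq_zero_or_pos u.length with hu | hu
  · obtain rfl := List.length_eq_zero_iff.mp hu
    simp [periodicCount, prefixCount]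
  · rw [periodicCount_length, periodicCount, Nat.add_mod_right, Nat.add_div_right _ hu, succ_nsmul,
      ← add_assoc, periodicCount]

theorem prefixCount_flatten_replicate (k : ℕ) {i : ℕ} (hi : i ≤ k * u.length) :
    prefixCount x (List.replicate k u).flatten i = periodicCount x u i := by
  induction k generalizing i with
  | zero =>
    obtain rfl : i = 0 := by simpa using hi
    simp [periodicCount_of_le]
  | succ k ih =>
    rw [List.replicate_succ, List.flatten_cons]
    rcases le_total i u.length with hiu | hiu
    · rw [prefixCount_append_of_le x u hiu, periodicCount_of_le x u hiu]
    · obtain ⟨j, rfl⟩ := Nat.exists_eq_add_of_le hiu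
      rw [prefixCount_append_add_length, ih (by rw [add_one_mul] at hi; omega), add_comm u.length,
        isAdditiveAlong_periodicCount_length, periodicCount_length, add_comm]

theorem periodicCount_flatten_replicate {k : ℕ} (hk : 0 < k) :
    periodicCount x (List.replicate k u).flatten = periodicCount x u := by
  have h_length : (List.replicate k u).flatten.length = k * u.length := by simp
  rcases Nat.eq_zero_or_pos u.length with hu | hu
  · obtain rfl := List.length_eq_zero_iff.mp hu
    simp
  have h_power := isAdditiveAlong_periodicCount_length x (List.replicate k u).flatten
  have h_base := (isAdditiveAlong_periodicCount_length x u).mul k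
  rw [h_length] at h_power
  rw [mul_comm] at h_base
  refine h_power.ext h_base (Nat.mul_pos hk hu) fun i hi => ?_
  rw [periodicCount_of_le x _ (h_length ▸ hi), prefixCount_flatten_replicate x u k hi]

theorem periodicCount_concat_pred_length_lt :
    periodicCount x (u ++ [x]) ((u ++ [x]).length - 1) <
      periodicCount x (u ++ [x]) (u ++ [x]).length := by
  rw [periodicCount_of_le x _ (Nat.sub_le _ _), periodicCount_length, prefixCount,
    ← List.dropLast_eq_take, List.dropLast_concat, List.count_append, List.count_singleton_self]
  push_cast
  exact lt_add_one _

end PrefixCount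

section Letter

variable {u v : Word}

theorem count_add_count {x y : Letter} (hxy : x ≠ y) (u : Word) :
    u.count x + u.count y = u.length := by
  induction u with
  | nil => rfl
  | cons z u ih => cases x <;> cases y <;> cases z <;> grind

theorem prefixCount_add_prefixCount {x y : Letter} (hxy : x ≠ y) {i : ℕ} (hi : i ≤ u.length) :
    prefixCount x u i + prefixCount y u i = i := by
  have h := count_add_count hxy (u.take i)
  rw [List.length_take_of_le hi] at h
  simp only [prefixCount]
  exact_mod_cast h

theorem eq_of_prefixCount_eq (y : Letter) (h_length : u.length = v.length)
    (h : ∀ i ≤ u.length, prefixCount y u i = prefixCount y v i) : u = v := by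
  refine List.ext_getElem h_length fun i hu hv => ?_
  have h_succ := h (i + 1) hu
  rw [prefixCount_succ y u hu, prefixCount_succ y v hv, h i hu.le, add_right_inj] at h_succ
  cases y <;> cases hui : u[i] <;> cases hvi : v[i] <;> simp_all

theorem isPower_iff (y : Letter) (hu : u ≠ []) :
    IsPower u ↔ ∃ k, 0 < k ∧ k < u.length ∧ IsAdditiveAlong (periodicCount y u) k := by
  constructor
  · rintro ⟨z, m, hm, rfl⟩
    have hz : z ≠ [] := by rintro rfl; simp at hu
    have hz_pos := List.length_pos_iff.mpr hz
    refine ⟨z.length, hz_pos, ?_, ?_⟩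
    · simpa using (Nat.mul_lt_mul_of_pos_right hm hz_pos)
    · rw [periodicCount_flatten_replicate y z (by omega)]
      exact isAdditiveAlong_periodicCount_length y z
  · rintro ⟨k, hk0, hkn, hk⟩
    have hd := hk.gcd (isAdditiveAlong_periodicCount_length y u)
    obtain ⟨m, hm⟩ := Nat.gcd_dvd_right k u.length
    have hd0 : 0 < k.gcd u.length := Nat.gcd_pos_of_pos_left _ hk0
    have hdk : k.gcd u.length ≤ k := Nat.gcd_le_left _ hk0
    set d := k.gcd u.length
    have h_length : (u.take d).length = d := List.length_take_of_le (by omega)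
    have h_count : periodicCount y (u.take d) = periodicCount y u := by
      have h_take := isAdditiveAlong_periodicCount_length y (u.take d)
      rw [h_length] at h_take
      refine h_take.ext hd hd0 fun i hi => ?_
      rw [periodicCount_of_le y _ (by omega), periodicCount_of_le y u (by omega), prefixCount,
        List.take_take, min_eq_left hi, prefixCount]
    have hm2 : 2 ≤ m := by
      by_contra h
      have := Nat.mul_le_mul_left d (show m ≤ 1 by omega)
      omega
    refine ⟨u.take d, m, hm2, eq_of_prefixCount_eq y ?_ fun i hi => ?_⟩
    · simpa [h_length, mul_comm] using hm
    · rw [prefixCount_flatten_replicate y _ m (by rw [h_length, mul_comm]; omega), h_count,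
        periodicCount_of_le y u hi]

end Letter

section Balanced

variable {w : Word}

theorem isBalanced_iff_count_le (y : Letter) :
    IsBalanced w ↔ ∀ u v : Word, u <:+: w → v <:+: w → u.length = v.length →
      (u.count y : ℤ) ≤ v.count y + 1 := by
  have count_a_add_count_b : ∀ u : Word, u.count .a + u.count .b = u.length :=
    count_add_count (by decide)
  constructor
  · intro h u v hu hv h_length
    have h_abs := abs_le.mp (h u v hu hv h_length)
    have := count_a_add_count_b u
    have := count_a_add_count_b v
    cases y <;> omega
  · intro h u v hu hv h_length
    have := h u v hu hv h_length
    have := h v u hv hu h_length.symm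
    have := count_a_add_count_b u
    have := count_a_add_count_b v
    rw [abs_le]
    cases y <;> omega

theorem isBalanced_iff_balancedOn (y : Letter) :
    IsBalanced w ↔ BalancedOn (prefixCount y w) 0 w.length := by
  rw [isBalanced_iff_count_le y]
  constructor
  · intro h i j m _ _ hi hj
    have h_infix : ∀ i, (w.drop i).take m <:+: w := fun i =>
      (List.take_prefix _ _).isInfix.trans (List.drop_suffix _ _).isInfix
    have := h _ _ (h_infix i) (h_infix j) (by simp only [List.length_take, List.length_drop]; omega)
    rw [prefixCount_add, prefixCount_add]
    omega
  · have exists_window : ∀ u, u <:+: w → ∃ i, i + u.length ≤ w.length ∧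
        prefixCount y w (i + u.length) - prefixCount y w i = u.count y := by
      rintro u ⟨s, t, rfl⟩
      exact ⟨s.length, by simp, by simp [prefixCount_add]⟩
    intro h u v hu hv h_length
    obtain ⟨i, hi, hu_count⟩ := exists_window u hu
    obtain ⟨j, hj, hv_count⟩ := exists_window v hv
    rw [← hu_count, ← hv_count, ← h_length]
    exact h i j _ (Nat.zero_le _) (Nat.zero_le _) hi (h_length ▸ hj)

theorem isBalanced_drop_take_iff (y : Letter) (s : ℕ) {e : ℕ} (he : e ≤ w.length) :
    IsBalanced ((w.take e).drop s) ↔ BalancedOn (prefixCount y w) s e := by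
  have h_length : ((w.take e).drop s).length = e - s := by
    rw [List.length_drop, List.length_take_of_le he]
  have h_count : ∀ i ≤ e - s, prefixCount y ((w.take e).drop s) i =
      prefixCount y w (s + i) - prefixCount y w s := fun i hi => by
    rcases le_total s e with hse | hes
    · exact prefixCount_drop_take y w (by omega)
    · obtain rfl : i = 0 := by omega
      simp
  rw [isBalanced_iff_balancedOn y, ← balancedOn_shift (prefixCount y w) s e, h_length]
  refine forall₃_congr fun i j m => forall₄_congr fun _ _ hi hj => ?_
  rw [h_count _ hi, h_count _ hj, h_count i (by omega), h_count j (by omega),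
    sub_sub_sub_cancel_right, sub_sub_sub_cancel_right]

theorem mem_minimalForbiddenWords_iff {α : Type*} {L : Language α} (h_nil : [] ∈ L)
    (h_factor : ∀ u v, u <:+: v → v ∈ L → u ∈ L) (v : List α) :
    v ∈ minimalForbiddenWords L ↔ v ∉ L ∧ v.tail ∈ L ∧ v.dropLast ∈ L := by
  refine and_congr_right fun hv => ⟨fun h => ?_, ?_⟩
  · have h_pos : 0 < v.length := List.length_pos_iff.mpr fun h => hv (h ▸ h_nil)
    refine ⟨h _ (List.tail_suffix v).isInfix fun h_eq => ?_,
      h _ (List.dropLast_prefix v).isInfix fun h_eq => ?_⟩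
    · have := congrArg List.length h_eq
      rw [List.length_tail] at this
      omega
    · have := congrArg List.length h_eq
      rw [List.length_dropLast] at this
      omega
  · rintro ⟨h_tail, h_dropLast⟩ u ⟨s, t, rfl⟩ hne
    rcases s with _ | ⟨x, s⟩
    · have ht : t ≠ [] := by rintro rfl; simp at hne
      refine h_factor _ _ ⟨[], t.dropLast, ?_⟩ h_dropLast
      simp [List.dropLast_append_of_ne_nil ht]
    · exact h_factor _ _ ⟨s, t, rfl⟩ h_tail

theorem mem_minimalForbiddenWords_sturmianLanguage_iff (y : Letter) :
    w ∈ minimalForbiddenWords sturmianLanguage ↔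
      MinimallyUnbalanced (prefixCount y w) w.length := by
  have h_nil : [] ∈ sturmianLanguage := fun u v hu hv _ => by
    simp [List.infix_nil.mp hu, List.infix_nil.mp hv]
  have h_factor : ∀ u v, u <:+: v → v ∈ sturmianLanguage → u ∈ sturmianLanguage :=
    fun _ _ h hv _ _ h₁ h₂ => hv _ _ (h₁.trans h) (h₂.trans h)
  have h_tail := isBalanced_drop_take_iff (w := w) y 1 le_rfl
  have h_dropLast := isBalanced_drop_take_iff (w := w) y 0 (Nat.sub_le w.length 1)
  rw [List.take_length, List.drop_one] at h_tail
  rw [List.drop_zero, ← List.dropLast_eq_take] at h_dropLast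
  rw [mem_minimalForbiddenWords_iff h_nil h_factor, MinimallyUnbalanced,
    ← isBalanced_iff_balancedOn, ← h_tail, ← h_dropLast]
  rfl

end Balanced

section SwappedEnds

variable {x y : Letter}

theorem prefixCount_swap_ends (hxy : x ≠ y) (w : Word) {i : ℕ} (hi : 0 < i)
    (hin : i < w.length + 2) :
    prefixCount y ([y] ++ w ++ [x]) i = prefixCount y ([x] ++ w ++ [y]) i + 1 := by
  have h_cons : ∀ z t : Letter, prefixCount y ([z] ++ w ++ [t]) i =
      [z].count y + prefixCount y w (i - 1) := fun z t => by
    obtain ⟨j, rfl⟩ := Nat.exists_eq_add_of_le hi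
    rw [List.append_assoc, Nat.add_sub_cancel_left,
      ← prefixCount_append_of_le y w (v := [t]) (by omega)]
    exact prefixCount_append_add_length y [z] (w ++ [t]) j
  rw [h_cons, h_cons, List.count_singleton_self, List.count_singleton]
  simp [hxy, add_comm]

theorem interiorRaise_swap_ends (hxy : x ≠ y) (w : Word) :
    InteriorRaise (prefixCount y ([y] ++ w ++ [x])) (periodicCount y ([x] ++ w ++ [y]))
      ([x] ++ w ++ [y]).length := by
  have h_length : ([x] ++ w ++ [y]).length = ([y] ++ w ++ [x]).length := by simp
  refine ⟨by simp [periodicCount_of_le], ?_, fun i hi hin => ?_⟩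
  · rw [periodicCount_length, h_length, prefixCount_length]
    simp only [List.count_append, Nat.cast_add]
    ring
  · have h_length' : ([x] ++ w ++ [y]).length = w.length + 2 := by simp
    rw [periodicCount_of_le y _ hin.le, prefixCount_swap_ends hxy w hi (h_length' ▸ hin)]

theorem periodicCount_one (hxy : x ≠ y) (w : Word) : periodicCount y ([x] ++ w ++ [y]) 1 = 0 := by
  rw [periodicCount_of_le y _ (by simp)]
  simp [prefixCount, hxy]

theorem mem_minimalForbiddenWords_swap_ends (hxy : x ≠ y) (w : Word) {k : ℕ}
    (h_almost : AlmostAdditive (periodicCount y ([x] ++ w ++ [y])))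
    (hk0 : 0 < k) (hkn : k < ([x] ++ w ++ [y]).length)
    (hk : IsAdditiveAlong (periodicCount y ([x] ++ w ++ [y])) k) :
    [y] ++ w ++ [x] ∈ minimalForbiddenWords sturmianLanguage := by
  have h_length : ([y] ++ w ++ [x]).length = ([x] ++ w ++ [y]).length := by simp
  rw [mem_minimalForbiddenWords_sturmianLanguage_iff y, h_length]
  exact (interiorRaise_swap_ends hxy w).minimallyUnbalanced h_almost
    (isAdditiveAlong_periodicCount_length y _) hk hk0 hkn

end SwappedEnds

section HeavyPrefix

variable {v : Word} {y : Letter} {k : ℕ}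

/-- The prefix of length `k` of `v` has at least two more letters `y` than the suffix of length
`k`. -/
def HasHeavyPrefix (y : Letter) (v : Word) (k : ℕ) : Prop :=
  0 < k ∧ k < v.length ∧
    prefixCount y v v.length + 2 ≤ prefixCount y v k + prefixCount y v (v.length - k)

theorem exists_hasHeavyPrefix (hv : v ∈ minimalForbiddenWords sturmianLanguage) :
    ∃ y k, HasHeavyPrefix y v k := by
  obtain ⟨k, hk0, hkn, hk⟩ :=
    ((mem_minimalForbiddenWords_sturmianLanguage_iff .b).mp hv).exists_prefix_suffix
  have h_sum : ∀ i ≤ v.length, prefixCount .a v i + prefixCount .b v i = i := fun i hi =>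
    prefixCount_add_prefixCount (by decide) hi
  have := h_sum k hkn.le
  have := h_sum (v.length - k) (Nat.sub_le _ _)
  have := h_sum v.length le_rfl
  rw [prefixCount_zero] at hk
  rcases hk with hk | hk
  · exact ⟨.b, k, hk0, hkn, by omega⟩
  · exact ⟨.a, k, hk0, hkn, by omega⟩

theorem HasHeavyPrefix.prefixCount_ends (hk : HasHeavyPrefix y v k)
    (hv : v ∈ minimalForbiddenWords sturmianLanguage) :
    1 ≤ prefixCount y v 1 ∧ prefixCount y v v.length ≤ prefixCount y v (v.length - 1) := by
  obtain ⟨hk0, hkn, h_heavy⟩ := hk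
  obtain ⟨-, h_suffix, h_prefix⟩ := (mem_minimalForbiddenWords_sturmianLanguage_iff y).mp hv
  have h_step : ∀ i < v.length, 0 ≤ prefixCount y v (i + 1) - prefixCount y v i ∧
      prefixCount y v (i + 1) - prefixCount y v i ≤ 1 := fun i hi => by
    rw [prefixCount_succ y v hi]
    split_ifs <;> simp
  have h_windows_suffix := h_suffix 1 (v.length - k + 1) (k - 1) le_rfl
    (by omega) (by omega) (by omega)
  have h_windows_prefix := h_prefix 0 (v.length - k) (k - 1) le_rfl
    (by omega) (by omega) (by omega)
  have h_step_prefix := h_step (k - 1) (by omega)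
  have h_step_suffix := h_step (v.length - k) (by omega)
  rw [Nat.add_sub_cancel' hk0, show v.length - k + 1 + (k - 1) = v.length by omega]
    at h_windows_suffix
  rw [zero_add, prefixCount_zero, show v.length - k + (k - 1) = v.length - 1 by omega]
    at h_windows_prefix
  rw [Nat.sub_add_cancel hk0] at h_step_prefix
  omega

theorem exists_eq_append_of_prefixCount_ends (hv : 2 ≤ v.length) (h_first : 1 ≤ prefixCount y v 1)
    (h_last : prefixCount y v v.length ≤ prefixCount y v (v.length - 1)) :
    ∃ x w, x ≠ y ∧ v = [y] ++ w ++ [x] := by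
  obtain ⟨z, t, rfl⟩ := List.exists_cons_of_length_pos (zero_lt_two.trans_le hv)
  obtain rfl | ⟨w, x, rfl⟩ := t.eq_nil_or_concat'
  · simp at hv
  obtain rfl : z = y := by
    by_contra hz
    simp [prefixCount, hz] at h_first
  refine ⟨x, w, ?_, rfl⟩
  rintro rfl
  rw [prefixCount_length, prefixCount, ← List.dropLast_eq_take, ← List.cons_append,
    List.dropLast_concat, List.count_append, List.count_singleton_self] at h_last
  push_cast at h_last
  omega

theorem exists_swap_ends_of_mem_minimalForbiddenWords
    (hv : v ∈ minimalForbiddenWords sturmianLanguage) :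
    ∃ x y w, x ≠ y ∧ AlmostAdditive (periodicCount y ([x] ++ w ++ [y])) ∧
      (∃ k, 0 < k ∧ k < ([x] ++ w ++ [y]).length ∧
        IsAdditiveAlong (periodicCount y ([x] ++ w ++ [y])) k) ∧
      v = [y] ++ w ++ [x] := by
  obtain ⟨y, k, hk⟩ := exists_hasHeavyPrefix hv
  obtain ⟨h_first, h_last⟩ := hk.prefixCount_ends hv
  obtain ⟨hk0, hkn, h_heavy⟩ := hk
  obtain ⟨x, w, hxy, rfl⟩ := exists_eq_append_of_prefixCount_ends (by omega) h_first h_last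
  obtain ⟨-, h_suffix, h_prefix⟩ := (mem_minimalForbiddenWords_sturmianLanguage_iff y).mp hv
  have h_length : ([y] ++ w ++ [x]).length = ([x] ++ w ++ [y]).length := by simp
  rw [h_length] at hkn h_heavy h_suffix h_prefix
  have h_raise := interiorRaise_swap_ends hxy w
  have hn := isAdditiveAlong_periodicCount_length y ([x] ++ w ++ [y])
  rw [h_raise.last, h_raise.interior k hk0 hkn, h_raise.interior _ (by omega) (by omega)] at h_heavy
  have h_one := periodicCount_one hxy w
  have h_pred := periodicCount_concat_pred_length_lt y ([x] ++ w)
  have hk := h_raise.isAdditiveAlong_of_last_le h_suffix h_prefix hn (by omega) hk0 hkn (by omega)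
  have h_almost := h_raise.almostAdditive h_suffix h_prefix hn hk hk0 hkn
  exact ⟨x, y, w, hxy, h_almost, ⟨k, hk0, hkn, hk⟩, rfl⟩

end HeavyPrefix

section Christoffel

theorem add_div_eq_ite {m q n : ℕ} (hq : q < n) :
    (m + q) / n = m / n + if (m + q) % n < m % n then 1 else 0 := by
  have hn : 0 < n := by omega
  have hm := Nat.mod_lt m hn
  rw [Nat.add_div hn, Nat.div_eq_of_lt hq, add_zero, Nat.add_mod, Nat.mod_eq_of_lt hq]
  rcases lt_or_ge (m % n + q) n with h | h
  · rw [Nat.mod_eq_of_lt h, if_neg (by omega), if_neg (by omega)]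
  · rw [Nat.mod_eq_sub_mod h, Nat.mod_eq_of_lt (show m % n + q - n < n by omega), if_pos h,
      if_pos (by omega)]

theorem add_mod_ne_mod {m q n : ℕ} (hq0 : 0 < q) (hq : q < n) : (m + q) % n ≠ m % n := fun h =>
  Nat.not_dvd_of_pos_of_lt hq0 hq <| by
    simpa using (Nat.modEq_iff_dvd' (Nat.le_add_right m q)).mp (Eq.symm h)

theorem prefixCount_eq_div {u : Word} {y : Letter} {q : ℕ} (hq : q < u.length)
    (hu : ∀ i (hi : i < u.length), u[i] = y ↔ (i + 1) * q % u.length < i * q % u.length)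
    {i : ℕ} (hi : i ≤ u.length) : prefixCount y u i = i * q / u.length := by
  suffices h : prefixCount y u i = (i * q / u.length : ℕ) by exact_mod_cast h
  induction i with
  | zero => simp
  | succ i ih =>
    rw [prefixCount_succ y u hi, ih (by omega), add_one_mul, add_div_eq_ite hq]
    simp only [hu i hi, add_one_mul]
    push_cast
    rfl

theorem prefixCount_lowerChristoffel {p q : ℕ} (hp : 0 < p) (hq : 0 < q) {i : ℕ}
    (hi : i ≤ p + q) : prefixCount .b (lowerChristoffel p q) i = i * q / ((p + q : ℕ) : ℤ) := by
  have h_length : (lowerChristoffel p q).length = p + q := by simp [lowerChristoffel]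
  rw [← h_length] at hi ⊢
  refine prefixCount_eq_div (by omega) (fun j hj => ?_) hi
  have h_ne := add_mod_ne_mod (m := j * q) hq (n := p + q) (by omega)
  rw [← add_one_mul] at h_ne
  simp only [lowerChristoffel, List.getElem_ofFn, List.length_ofFn]
  grind

theorem prefixCount_upperChristoffel {p q : ℕ} (hq : 0 < q) {i : ℕ}
    (hi : i ≤ p + q) : prefixCount .a (upperChristoffel p q) i = i * p / ((p + q : ℕ) : ℤ) := by
  have h_length : (upperChristoffel p q).length = p + q := by simp [upperChristoffel]
  rw [← h_length] at hi ⊢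
  refine prefixCount_eq_div (by omega) (fun j hj => ?_) hi
  simp [upperChristoffel]

theorem isChristoffel_iff_prefixCount_eq {u : Word} :
    IsChristoffel u ↔ ∃ y, 0 < u.count y ∧ u.count y < u.length ∧
      ∀ i ≤ u.length, prefixCount y u i = i * u.count y / u.length := by
  have h_lower_length : ∀ p q, (lowerChristoffel p q).length = p + q := by simp [lowerChristoffel]
  have h_upper_length : ∀ p q, (upperChristoffel p q).length = p + q := by simp [upperChristoffel]
  constructor
  · rintro ⟨p, q, hp, hq, rfl | rfl⟩
    · have h_count : (lowerChristoffel p q).count .b = q := by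
        have h := prefixCount_lowerChristoffel hp hq le_rfl
        rw [← h_lower_length p q, prefixCount_length, h_lower_length,
          Int.mul_ediv_cancel_left _ (by omega)] at h
        exact_mod_cast h
      refine ⟨.b, ?_⟩
      rw [h_count, h_lower_length]
      exact ⟨hq, by omega, fun i hi => prefixCount_lowerChristoffel hp hq hi⟩
    · have h_count : (upperChristoffel p q).count .a = p := by
        have h := prefixCount_upperChristoffel hq (le_refl (p + q))
        rw [← h_upper_length p q, prefixCount_length, h_upper_length,
          Int.mul_ediv_cancel_left _ (by omega)] at h
        exact_mod_cast h
      refine ⟨.a, ?_⟩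
      rw [h_count, h_upper_length]
      exact ⟨hp, by omega, fun i hi => prefixCount_upperChristoffel hq hi⟩
  · rintro ⟨y, h_pos, h_lt, h⟩
    have h_sum : u.count .a + u.count .b = u.length := count_add_count (by decide) u
    cases y
    · refine ⟨u.count .a, u.count .b, h_pos, by omega, .inr (eq_of_prefixCount_eq .a ?_ ?_)⟩
      · rw [h_upper_length, h_sum]
      · intro i hi
        rw [h i hi, prefixCount_upperChristoffel (by omega) (by omega), h_sum]
    · refine ⟨u.count .a, u.count .b, by omega, h_pos, .inl (eq_of_prefixCount_eq .b ?_ ?_)⟩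
      · rw [h_lower_length, h_sum]
      · intro i hi
        rw [h i hi, prefixCount_lowerChristoffel (by omega) (by omega) (by omega), h_sum]

theorem almostAdditive_periodicCount_iff {α : Type*} [DecidableEq α] {u : List α} (x : α)
    (hu : u ≠ []) : AlmostAdditive (periodicCount x u) ↔
      ∀ i ≤ u.length, prefixCount x u i = i * u.count x / u.length := by
  have h_pos := List.length_pos_iff.mpr hu
  have h_period := isAdditiveAlong_periodicCount_length x u
  constructor
  · intro h i hi
    rw [← periodicCount_of_le x u hi, h.eq_floor h_period h_pos, periodicCount_length]
  · intro h
    have h_floor : periodicCount x u = fun i : ℕ => (i : ℤ) * u.count x / u.length :=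
      h_period.ext (isAdditiveAlong_floor _ h_pos) h_pos fun i hi => by
        rw [periodicCount_of_le x u hi, h i hi]
    rw [h_floor]
    exact almostAdditive_floor _ (by exact_mod_cast h_pos)

theorem isChristoffel_swap_ends_iff {x y : Letter} (hxy : x ≠ y) (w : Word) :
    IsChristoffel ([x] ++ w ++ [y]) ↔ AlmostAdditive (periodicCount y ([x] ++ w ++ [y])) := by
  rw [isChristoffel_iff_prefixCount_eq, almostAdditive_periodicCount_iff y (by simp)]
  constructor
  · rintro ⟨z, -, hz_lt, hz⟩
    have h_first : prefixCount z ([x] ++ w ++ [y]) 1 = 0 := by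
      rw [hz 1 (by simp), Nat.cast_one, one_mul]
      exact Int.ediv_eq_zero_of_lt (by positivity) (by exact_mod_cast hz_lt)
    have hzx : z ≠ x := by
      rintro rfl
      simp [prefixCount] at h_first
    obtain rfl : z = y := by cases x <;> cases y <;> cases z <;> simp_all
    exact hz
  · intro h
    have h_sum := count_add_count hxy ([x] ++ w ++ [y])
    have hx_pos : 0 < ([x] ++ w ++ [y]).count x := List.count_pos_iff.mpr (by simp)
    exact ⟨y, List.count_pos_iff.mpr (by simp), by omega, h⟩

end Christoffel

end SturmianWords

theorem mainTheorem4 :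
    SturmianWords.minimalForbiddenWords SturmianWords.sturmianLanguage =
      {v : SturmianWords.Word | ∃ (x y : SturmianWords.Letter) (w : SturmianWords.Word),
        x ≠ y ∧
        SturmianWords.IsChristoffel ([x] ++ w ++ [y]) ∧
        ¬ SturmianWords.IsPrimitive ([x] ++ w ++ [y]) ∧
        v = [y] ++ w ++ [x]} := by
  open SturmianWords in
  ext v
  constructor
  · intro hv
    obtain ⟨x, y, w, hxy, h_almost, h_additive, h_eq⟩ :=
      exists_swap_ends_of_mem_minimalForbiddenWords hv
    exact ⟨x, y, w, hxy, (isChristoffel_swap_ends_iff hxy w).mpr h_almost,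
      not_not.mpr ((isPower_iff y (by simp)).mpr h_additive), h_eq⟩
  · rintro ⟨x, y, w, hxy, h_christoffel, h_power, rfl⟩
    obtain ⟨k, hk0, hkn, hk⟩ := (isPower_iff y (by simp)).mp (not_not.mp h_power)
    exact mem_minimalForbiddenWords_swap_ends hxy w
      ((isChristoffel_swap_ends_iff hxy w).mp h_christoffel) hk0 hkn hk
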